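/- Let $X$ be a finite set of boxes, let $(f(x))_{x\in X}$ be mutually independent real random variables with $\mathbb{E}|f(x)|<\infty$ (no assumption on their supports), let $c(x)>0$ be deterministic costs, and let $B\in\mathbb{R}$. All boxes are initially closed. At each step one either opens a closed box $x$, which costs $c(x)$ and reveals $f(x)$, or stops and takes the reward in a box that is already open; at least one box has to be opened. A policy is a (randomized) Markov policy: a measurable map from states (which boxes are open, and the rewards in them) to probability distributions on actions. In the expected budget-constrained problem, one maximizes the expected reward taken among the policies whose expected total cost of opened boxes is at most $B$; a policy that attains this maximum and whose expected total cost is at most $B$ is called Bayesian-optimal. Assume that the problem is feasible and the constraint is active, in the sense that $\min_{x\in X}c(x)<B<\sum_{x\in X}c(x)$ and that every policy which maximizes the expected reward among all policies, regardless of cost, has expected total cost larger than $B$. Then there exist $\lambda>0$ and a tie-breaking rule such that the following Gittins index policy is Bayesian-optimal for the expected budget-constrained problem. For each $x$ let $\alpha^\star(x)$ be the solution $g$ of $\mathbb{E}\max(0,f(x)-g)=\lambda c(x)$. As long as the best reward found so far is smaller than the largest index of a closed box (or no box is open), the policy opens a closed box of largest index; if it is larger than all those indices (or no box is closed), the policy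 stops and takes the best reward found. If the best reward found equals the largest index of a closed box, the policy may do either. The tie-breaking rule, which may be randomized, chooses among the tied actions, on the basis of the set of open boxes and the set of tied actions. -/

import Mathlib

open MeasureTheory ProbabilityTheory

namespace Pandora

noncomputable section

/-- States of the decision process. `Sum.inl v` in coordinate `x` means that box `x` has been opened
and contains the reward `v`; `Sum.inr ()` means that box `x` is still closed. -/
abbrev State (X : Type*) : Type _ := X → ℝ ⊕ Unit

/-- The state in which exactly the boxes of `S` are open, `r` being the (hidden) rewards. -/
def obs {X : Type*} [DecidableEq X] (r : X → ℝ) (S : Finset X) : State X :=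
  fun x => if x ∈ S then Sum.inl (r x) else Sum.inr ()

/-- The boxes that are open in the state `s`. -/
def openBoxes {X : Type*} [Fintype X] (s : State X) : Finset X :=
  Finset.univ.filter fun x => (s x).isLeft = true

/-- Randomized Markov policies: measurable maps (that is, probability kernels) from states to
probability distributions on the actions. The action `a : X` means: open box `a` if it is closed;
if it is open, stop and take the reward in it. -/
structure Policy (X : Type*) where
  act : State X → PMF X
  measurable_act : ∀ a, Measurable fun s => act s a

/-- The law of the outcome `(S, a)` of the process (`S` the set of all boxes opened, `a ∈ S` the box
taken), when the hidden rewards are `r`, the boxes of `S` are open now and `n` boxes are closed.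
With `n = 0` all the boxes are open, so that every action takes a reward. -/
def Policy.run {X : Type*} [DecidableEq X] (π : Policy X) (r : X → ℝ) :
    ℕ → Finset X → PMF (Finset X × X)
  | 0, S => (π.act (obs r S)).map fun a => (S, a)
  | n + 1, S => (π.act (obs r S)).bind fun a =>
      if a ∈ S then PMF.pure (S, a) else Policy.run π r n (insert a S)

/-- The law of the outcome of the whole process, which starts with all boxes closed, given the
hidden rewards `r`. -/
def Policy.outcome {X : Type*} [Fintype X] [DecidableEq X] (π : Policy X) (r : X → ℝ) :
    PMF (Finset X × X) :=
  π.run r (Fintype.card X) ∅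

/-- The expected reward of the box taken at the end. -/
def Policy.expectedReward {Ω X : Type*} [MeasurableSpace Ω] [Fintype X] [DecidableEq X]
    (P : Measure Ω) (f : X → Ω → ℝ) (π : Policy X) : ℝ :=
  ∫ ω, ∑ o : Finset X × X, (π.outcome (fun x => f x ω) o).toReal * f o.2 ω ∂P

/-- The expected total cost of the boxes opened. -/
def Policy.expectedCost {Ω X : Type*} [MeasurableSpace Ω] [Fintype X] [DecidableEq X]
    (P : Measure Ω) (f : X → Ω → ℝ) (c : X → ℝ) (π : Policy X) : ℝ :=
  ∫ ω, ∑ o : Finset X × X, (π.outcome (fun x => f x ω) o).toReal * ∑ x ∈ o.1, c x ∂P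

/-- Optimality for the problem without a budget: the policy maximizes the expected reward among
all policies. -/
def IsUnconstrainedOptimal {Ω X : Type*} [MeasurableSpace Ω] [Fintype X] [DecidableEq X]
    (P : Measure Ω) (f : X → Ω → ℝ) (π : Policy X) : Prop :=
  ∀ π' : Policy X, π'.expectedReward P f ≤ π.expectedReward P f

/-- The budget constraint is active: no policy that maximizes the expected reward without regard
to costs meets the budget. -/
def BudgetActive {Ω X : Type*} [MeasurableSpace Ω] [Fintype X] [DecidableEq X]
    (P : Measure Ω) (f : X → Ω → ℝ) (c : X → ℝ) (B : ℝ) : Prop :=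
  ∀ π : Policy X, IsUnconstrainedOptimal P f π → B < π.expectedCost P f c

/-- Bayesian optimality for the expected budget-constrained problem: the policy meets the budget in
expectation, and maximizes the expected reward among all policies that do. -/
def IsBudgetOptimal {Ω X : Type*} [MeasurableSpace Ω] [Fintype X] [DecidableEq X]
    (P : Measure Ω) (f : X → Ω → ℝ) (c : X → ℝ) (B : ℝ) (π : Policy X) : Prop :=
  π.expectedCost P f c ≤ B ∧
    ∀ π' : Policy X, π'.expectedCost P f c ≤ B → π'.expectedReward P f ≤ π.expectedReward P f

/-- The expected improvement of the random variable `Y` over the value `g`. -/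
def expectedImprovement {Ω : Type*} [MeasurableSpace Ω] (P : Measure Ω) (Y : Ω → ℝ) (g : ℝ) : ℝ :=
  ∫ ω, max 0 (Y ω - g) ∂P

/-- `α` is the Gittins index of the boxes with rewards `f` and costs `k`: for each box `x`, the
number `α x` solves the equation `EI (α x) = k x` (it is the only solution when `0 < k x`). -/
def IsGittinsIndex {Ω X : Type*} [MeasurableSpace Ω] (P : Measure Ω) (f : X → Ω → ℝ)
    (k : X → ℝ) (α : X → ℝ) : Prop :=
  ∀ x, expectedImprovement P (f x) (α x) = k x

/-- The value by which the Gittins policy ranks the action `x`: the index `α x` if box `x` is closed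
(and would be opened), the reward in it if it is open (and would be taken). -/
def score {X : Type*} (α : X → ℝ) (s : State X) (x : X) : ℝ :=
  Sum.elim (fun v => v) (fun _ => α x) (s x)

/-- The actions among which the Gittins policy may choose: if the best open reward is below the
largest index of a closed box (or nothing is open), the closed boxes of largest index; if it is above
(or nothing is closed), the open boxes of largest reward; in case of equality, all of these. -/
def gittinsActions {X : Type*} [Fintype X] (α : X → ℝ) (s : State X) : Finset X :=
  Finset.univ.filter fun a => ∀ b, score α s b ≤ score α s a

/-- A (possibly randomized) tie-breaking rule: given the set `O` of the open boxes and the set `A` of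
the tied actions, it chooses an action of `A`. So it settles both which box to open and whether
to stop in a tie between stopping and opening. -/
structure TieBreakingRule (X : Type*) where
  choose : Finset X → Finset X → PMF X
  choose_mem : ∀ O A : Finset X, A.Nonempty → ∀ a ∈ (choose O A).support, a ∈ A

theorem measurable_score {X : Type*} (α : X → ℝ) (x : X) :
    Measurable fun s : State X => score α s x :=
  (measurable_fun_sum (f := Sum.elim (fun v : ℝ => v) (fun _ : Unit => α x))
    measurable_id measurable_const).comp (measurable_pi_apply x)

theorem measurableSet_openBoxes {X : Type*} [Fintype X] (x : X) :
    MeasurableSet {s : State X | x ∈ openBoxes s} := by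
  have h : Measurable fun s : State X => (s x).isLeft :=
    (measurable_fun_sum (f := Sum.isLeft) measurable_const measurable_const).comp
      (measurable_pi_apply x)
  have e : {s : State X | x ∈ openBoxes s} = (fun s : State X => (s x).isLeft) ⁻¹' {true} := by
    ext s
    simp [openBoxes]
  rw [e]
  exact h (measurableSet_singleton true)

theorem measurableSet_gittinsActions {X : Type*} [Fintype X] (α : X → ℝ) (x : X) :
    MeasurableSet {s : State X | x ∈ gittinsActions α s} := by
  simp only [gittinsActions, Finset.mem_filter, Finset.mem_univ, true_and, Set.ofPred_forall]
  exact MeasurableSet.iInter fun b =>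
    measurableSet_le (measurable_score α b) (measurable_score α x)

theorem measurableSet_finset_eq {S X : Type*} [MeasurableSpace S] [Fintype X] (F : S → Finset X)
    (hF : ∀ x, MeasurableSet {s | x ∈ F s}) (A : Finset X) : MeasurableSet {s | F s = A} := by
  have h : {s | F s = A} = ⋂ x, {s | x ∈ F s ↔ x ∈ A} := by
    ext s
    simp [Finset.ext_iff]
  rw [h]
  exact MeasurableSet.iInter fun x => (hF x).iff (MeasurableSet.const _)

theorem measurable_choose {X : Type*} [Fintype X] (τ : TieBreakingRule X) (α : X → ℝ) (a : X) :
    Measurable fun s : State X => τ.choose (openBoxes s) (gittinsActions α s) a := by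
  classical
  intro U _
  have h : (fun s : State X => τ.choose (openBoxes s) (gittinsActions α s) a) ⁻¹' U =
      ⋃ q : {q : Finset X × Finset X // τ.choose q.1 q.2 a ∈ U},
        {s | openBoxes s = q.1.1} ∩ {s | gittinsActions α s = q.1.2} := by
    ext s
    simp
  rw [h]
  exact MeasurableSet.iUnion fun q =>
    (measurableSet_finset_eq _ measurableSet_openBoxes _).inter
      (measurableSet_finset_eq _ (measurableSet_gittinsActions α) _)

/-- The Gittins index policy for the index `α`, with ties broken by the rule `τ`. -/
def gittinsPolicy {X : Type*} [Fintype X] (α : X → ℝ) (τ : TieBreakingRule X) : Policy X where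
  act s := τ.choose (openBoxes s) (gittinsActions α s)
  measurable_act := measurable_choose τ α

end

end Pandora

/-!
The budget enters through a Lagrange multiplier `t > 0`: with the costs `t * c x`, every Gittins
policy, whatever its tie-breaking rule, maximizes the expected reward minus `t` times the expected
cost (`gittinsPolicy_optimal`). Hence a Gittins policy whose expected cost is exactly `B` is optimal
for the budget-constrained problem (`isBudgetOptimal_of_expectedCost_eq`), and it remains to find a
multiplier and a tie-breaking rule that exhaust the budget.

*Optimality for the Lagrangian.* The decision to open `x` is independent of `f x`, and the index
satisfies `E (f x - α x)⁺ = t * c x`. So each cost may be replaced by the excess `(f x - α x)⁺`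
(`Policy.integral_amortizedValue`). After this replacement every outcome that takes box `a` is worth
at most `min (f a) (α a)`, and every outcome of a Gittins policy is worth at least
`min (f b) (α b)` for all `b` (`le_amortizedValue_of_mem_support_run`).

*Exhausting the budget.* Let `L` be the set of the multipliers at which the Gittins policy with a
fixed rule costs at most `B`. It is nonempty (`exists_multiplier_expectedCost_le`). Expected costs
and rewards are continuous under pointwise convergence of policies (`tendsto_integral_outcome`).
When the multiplier tends to `l > 0` strictly from one side, a subsequence of the Gittins policies
is eventually equal, in each state, to a Gittins policy for `l`, with a tie-breaking rule that
depends on the side (`exists_limit_rule`). When the multiplier tends to `0`, a subsequence converges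
in the same sense to a policy which is optimal without a budget; as the budget is active, this one
costs more than `B`, so that `0 < inf L` (`not_tendsto_zero_of_budgetActive`). At `inf L`, limits
from the right and from the left give two rules with costs at most and at least `B`, and a mixture
of the two costs exactly `B` (`exists_rule_expectedCost_eq`).
-/

open Filter Topology

namespace Pandora

/-! ### The outcome as a function of the rewards and of the policy -/

section Outcome

variable {X : Type*} [Fintype X] [DecidableEq X]

theorem Policy.run_zero_apply (π : Policy X) (r : X → ℝ) (S : Finset X) (o : Finset X × X) :
    π.run r 0 S o = ∑ a, π.act (obs r S) a * if o = (S, a) then 1 else 0 := by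
  rw [Policy.run, PMF.map_apply, tsum_fintype]
  refine Finset.sum_congr rfl fun a _ => ?_
  split_ifs <;> simp

theorem Policy.run_succ_apply (π : Policy X) (r : X → ℝ) (n : ℕ) (S : Finset X)
    (o : Finset X × X) :
    π.run r (n + 1) S o = ∑ a, π.act (obs r S) a *
      if a ∈ S then (if o = (S, a) then 1 else 0) else π.run r n (insert a S) o := by
  rw [Policy.run, PMF.bind_apply, tsum_fintype]
  refine Finset.sum_congr rfl fun a _ => ?_
  split_ifs <;> simp_all [PMF.pure_apply]

theorem measurable_obs {X : Type*} [DecidableEq X] (S : Finset X) :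
    Measurable fun r : X → ℝ => obs r S := by
  refine measurable_pi_iff.2 fun x => ?_
  by_cases hx : x ∈ S
  · simpa [obs, hx, Function.comp_def] using measurable_inl.comp (measurable_pi_apply x)
  · simp [obs, hx]

theorem Policy.measurable_run (π : Policy X) (n : ℕ) (S : Finset X) (o : Finset X × X) :
    Measurable fun r => π.run r n S o := by
  have hact (S : Finset X) (a : X) : Measurable fun r => π.act (obs r S) a :=
    (π.measurable_act a).comp (measurable_obs S)
  induction n generalizing S with
  | zero =>
    simp only [Policy.run_zero_apply]
    exact Finset.measurable_sum _ fun a _ => (hact S a).mul_const _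
  | succ n ih =>
    simp only [Policy.run_succ_apply]
    refine Finset.measurable_sum _ fun a _ => (hact S a).mul ?_
    by_cases ha : a ∈ S
    · simp [ha]
    · simpa [ha] using ih (insert a S)

theorem tendsto_run {ι : Type*} {l : Filter ι} {p : ι → Policy X} {π : Policy X}
    (h : ∀ s a, Tendsto (fun i => (p i).act s a) l (𝓝 (π.act s a)))
    (r : X → ℝ) (n : ℕ) (S : Finset X) (o : Finset X × X) :
    Tendsto (fun i => (p i).run r n S o) l (𝓝 (π.run r n S o)) := by
  induction n generalizing S with
  | zero =>
    simp only [Policy.run_zero_apply]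
    refine tendsto_finsetSum _ fun a _ => ENNReal.Tendsto.mul (h _ a) (Or.inr ?_)
      tendsto_const_nhds (Or.inr (PMF.apply_ne_top _ _))
    split_ifs <;> simp
  | succ n ih =>
    simp only [Policy.run_succ_apply]
    refine tendsto_finsetSum _ fun a _ => ENNReal.Tendsto.mul (h _ a) (Or.inr ?_) ?_
      (Or.inr (PMF.apply_ne_top _ _))
    · split_ifs <;> simp [PMF.apply_ne_top]
    · by_cases ha : a ∈ S
      · simp only [ha, if_true, tendsto_const_nhds]
      · simpa [ha] using ih (insert a S)

theorem Policy.sum_outcome_toReal (π : Policy X) (r : X → ℝ) :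
    ∑ o, (π.outcome r o).toReal = 1 := by
  rw [← ENNReal.toReal_sum fun o _ => PMF.apply_ne_top _ o, ← tsum_fintype (L := .unconditional _),
    PMF.tsum_coe, ENNReal.toReal_one]

theorem Policy.outcome_toReal_le_one (π : Policy X) (r : X → ℝ) (o : Finset X × X) :
    (π.outcome r o).toReal ≤ 1 :=
  ENNReal.toReal_le_of_le_ofReal zero_le_one (by simpa using PMF.coe_le_one _ o)

variable {Ω : Type*} [MeasurableSpace Ω] {P : Measure Ω} {f : X → Ω → ℝ}

theorem Policy.aestronglyMeasurable_outcome (π : Policy X) (hf : ∀ x, AEMeasurable (f x) P)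
    (o : Finset X × X) :
    AEStronglyMeasurable (fun ω => (π.outcome (fun x => f x ω) o).toReal) P :=
  ((π.measurable_run _ ∅ o).ennreal_toReal.comp_aemeasurable
    (aemeasurable_pi_lambda _ hf)).aestronglyMeasurable

theorem Policy.integrable_outcome_mul (π : Policy X) (hf : ∀ x, AEMeasurable (f x) P)
    {v : Ω → ℝ} (hv : Integrable v P) (o : Finset X × X) :
    Integrable (fun ω => (π.outcome (fun x => f x ω) o).toReal * v ω) P :=
  hv.bdd_mul (c := 1) (π.aestronglyMeasurable_outcome hf o) <| .of_forall fun ω => by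
    simpa using π.outcome_toReal_le_one _ o

/-- Expected payoffs are continuous in the policy, for the pointwise convergence of the action
probabilities. -/
theorem tendsto_integral_outcome (hf : ∀ x, AEMeasurable (f x) P)
    {v : Finset X × X → Ω → ℝ} (hv : ∀ o, Integrable (v o) P)
    {ι : Type*} {l : Filter ι} [l.IsCountablyGenerated] {p : ι → Policy X} {π : Policy X}
    (h : ∀ s a, Tendsto (fun i => (p i).act s a) l (𝓝 (π.act s a))) :
    Tendsto (fun i => ∫ ω, ∑ o, ((p i).outcome (fun x => f x ω) o).toReal * v o ω ∂P) l
      (𝓝 (∫ ω, ∑ o, (π.outcome (fun x => f x ω) o).toReal * v o ω ∂P)) := by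
  refine tendsto_integral_filter_of_dominated_convergence (fun ω => ∑ o, |v o ω|)
    (.of_forall fun i => (integrable_finsetSum _ fun o _ =>
      (p i).integrable_outcome_mul hf (hv o) o).aestronglyMeasurable)
    (.of_forall fun i => .of_forall fun ω => ?_)
    (integrable_finsetSum _ fun o _ => (hv o).abs) (.of_forall fun ω => ?_)
  · refine (norm_sum_le _ _).trans (Finset.sum_le_sum fun o _ => ?_)
    rw [norm_mul, Real.norm_eq_abs, Real.norm_eq_abs, ENNReal.abs_toReal]
    exact mul_le_of_le_one_left (abs_nonneg _) ((p i).outcome_toReal_le_one _ o)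
  · exact tendsto_finsetSum _ fun o _ =>
      ((ENNReal.tendsto_toReal (PMF.apply_ne_top _ _)).comp (tendsto_run h _ _ _ _)).mul_const _

theorem tendsto_expectedReward (hf : ∀ x, Integrable (f x) P)
    {ι : Type*} {l : Filter ι} [l.IsCountablyGenerated] {p : ι → Policy X} {π : Policy X}
    (h : ∀ s a, Tendsto (fun i => (p i).act s a) l (𝓝 (π.act s a))) :
    Tendsto (fun i => (p i).expectedReward P f) l (𝓝 (π.expectedReward P f)) :=
  tendsto_integral_outcome (fun x => (hf x).aemeasurable) (fun o => hf o.2) h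

theorem tendsto_expectedCost [IsProbabilityMeasure P] (hf : ∀ x, Integrable (f x) P) (c : X → ℝ)
    {ι : Type*} {l : Filter ι} [l.IsCountablyGenerated] {p : ι → Policy X} {π : Policy X}
    (h : ∀ s a, Tendsto (fun i => (p i).act s a) l (𝓝 (π.act s a))) :
    Tendsto (fun i => (p i).expectedCost P f c) l (𝓝 (π.expectedCost P f c)) :=
  tendsto_integral_outcome (fun x => (hf x).aemeasurable)
    (v := fun o _ => ∑ x ∈ o.1, c x) (fun _ => integrable_const _) h

theorem Policy.abs_expectedReward_le (π : Policy X) (hf : ∀ x, Integrable (f x) P) :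
    |π.expectedReward P f| ≤ ∫ ω, ∑ x, |f x ω| ∂P := by
  rw [← Real.norm_eq_abs, Policy.expectedReward]
  refine norm_integral_le_of_norm_le (integrable_finsetSum _ fun x _ => (hf x).abs)
    (.of_forall fun ω => ?_)
  refine (norm_sum_le _ _).trans ?_
  calc ∑ o : Finset X × X, ‖(π.outcome (fun x => f x ω) o).toReal * f o.2 ω‖
      ≤ ∑ o : Finset X × X, (π.outcome (fun x => f x ω) o).toReal * ∑ x, |f x ω| := by
        refine Finset.sum_le_sum fun o _ => ?_
        rw [norm_mul, Real.norm_eq_abs, Real.norm_eq_abs, ENNReal.abs_toReal]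
        exact mul_le_mul_of_nonneg_left
          (Finset.single_le_sum (f := fun x => |f x ω|) (fun x _ => abs_nonneg _)
            (Finset.mem_univ o.2)) ENNReal.toReal_nonneg
    _ = ∑ x, |f x ω| := by rw [← Finset.sum_mul, π.sum_outcome_toReal, one_mul]

end Outcome

/-! ### The Gittins index -/

section Index

variable {Ω : Type*} [MeasurableSpace Ω] {P : Measure Ω} [IsProbabilityMeasure P] {Y : Ω → ℝ}

theorem integrable_improvement (hY : Integrable Y P) (g : ℝ) :
    Integrable (fun ω => max 0 (Y ω - g)) P :=
  (integrable_zero _ _ _).sup (hY.sub (integrable_const g))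

theorem antitone_expectedImprovement (hY : Integrable Y P) :
    Antitone (expectedImprovement P Y) := fun _ _ h =>
  integral_mono (integrable_improvement hY _) (integrable_improvement hY _) fun _ =>
    max_le_max_left _ (sub_le_sub_left h _)

theorem expectedImprovement_nonneg {Ω : Type*} [MeasurableSpace Ω] (P : Measure Ω) (Y : Ω → ℝ)
    (g : ℝ) : 0 ≤ expectedImprovement P Y g :=
  integral_nonneg fun _ => le_max_left _ _

/-- The expected improvement decreases strictly as long as it is positive. -/
theorem expectedImprovement_lt (hY : Integrable Y P) {a b : ℝ} (hab : a < b)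
    (ha : 0 < expectedImprovement P Y a) :
    expectedImprovement P Y b < expectedImprovement P Y a := by
  refine lt_of_le_of_ne (antitone_expectedImprovement hY hab.le) fun h => ha.ne' ?_
  -- equality of the integrals forces `Y ≤ a` almost surely
  have hae := (integral_eq_iff_of_ae_le (integrable_improvement hY b)
    (integrable_improvement hY a) (.of_forall fun _ =>
      max_le_max_left _ (sub_le_sub_left hab.le _))).1 h
  refine integral_eq_zero_of_ae (hae.mono fun ω hω => ?_)
  by_contra hne
  have hlt : a < Y ω := by
    by_contra hle
    exact hne (max_eq_left (by linarith))
  rcases max_cases 0 (Y ω - b) with h1 | h1 <;> rcases max_cases 0 (Y ω - a) with h2 | h2 <;>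
    linarith

theorem continuous_expectedImprovement (hY : Integrable Y P) :
    Continuous (expectedImprovement P Y) := by
  refine (LipschitzWith.of_dist_le_mul (K := 1) fun a b => ?_).continuous
  rw [NNReal.coe_one, one_mul, dist_eq_norm, expectedImprovement, expectedImprovement,
    ← integral_sub (integrable_improvement hY a) (integrable_improvement hY b)]
  refine (norm_integral_le_of_norm_le (integrable_const (dist a b)) (.of_forall fun ω => ?_)).trans
    (by simp)
  refine (abs_max_sub_max_le_max _ _ _ _).trans ?_
  rw [sub_self, abs_zero, sub_sub_sub_cancel_left, max_eq_right (abs_nonneg _), dist_comm,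
    Real.dist_eq]

theorem tendsto_expectedImprovement_atTop (hY : Integrable Y P) :
    Tendsto (expectedImprovement P Y) atTop (𝓝 0) := by
  have h := tendsto_integral_filter_of_dominated_convergence (μ := P) (l := atTop)
    (F := fun (g : ℝ) ω => max 0 (Y ω - g)) (f := fun _ => 0) (fun ω => |Y ω|)
    (.of_forall fun g => (integrable_improvement hY g).aestronglyMeasurable)
    ((eventually_ge_atTop 0).mono fun g hg => .of_forall fun ω => ?_) hY.abs
    (.of_forall fun ω => ?_)
  · rwa [integral_zero] at h
  · rw [Real.norm_eq_abs, abs_of_nonneg (le_max_left _ _)]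
    exact max_le (abs_nonneg _) ((sub_le_self _ hg).trans (le_abs_self _))
  · exact tendsto_const_nhds.congr' ((eventually_ge_atTop (Y ω)).mono fun g hg =>
      (max_eq_left (sub_nonpos.2 hg)).symm)

theorem exists_expectedImprovement_eq (hY : Integrable Y P) {k : ℝ} (hk : 0 < k) :
    ∃ g, expectedImprovement P Y g = k := by
  refine mem_range_of_exists_le_of_exists_ge (continuous_expectedImprovement hY)
    ((tendsto_expectedImprovement_atTop hY).eventually_le_const hk).exists
    ⟨(∫ ω, Y ω ∂P) - k, ?_⟩
  calc k = ∫ ω, (Y ω - ((∫ ω, Y ω ∂P) - k)) ∂P := by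
        rw [integral_sub hY (integrable_const _)]; simp
    _ ≤ _ := integral_mono (hY.sub (integrable_const _)) (integrable_improvement hY _) fun _ =>
        le_max_right _ _

variable {X : Type*} {f : X → Ω → ℝ} {k α : X → ℝ}

theorem exists_isGittinsIndex (hf : ∀ x, Integrable (f x) P) (hk : ∀ x, 0 < k x) :
    ∃ α, IsGittinsIndex P f k α :=
  Classical.skolem.1 fun x => exists_expectedImprovement_eq (hf x) (hk x)

theorem IsGittinsIndex.lt_iff (hα : IsGittinsIndex P f k α) (hf : ∀ x, Integrable (f x) P)
    (hk : ∀ x, 0 < k x) {x : X} {v : ℝ} : v < α x ↔ k x < expectedImprovement P (f x) v := by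
  rw [← hα x]
  refine ⟨fun h => expectedImprovement_lt (hf x) h ?_,
    fun h => (antitone_expectedImprovement (hf x)).reflect_lt h⟩
  exact ((hk x).trans_eq (hα x).symm).trans_le (antitone_expectedImprovement (hf x) h.le)

theorem IsGittinsIndex.gt_iff (hα : IsGittinsIndex P f k α) (hf : ∀ x, Integrable (f x) P)
    (hk : ∀ x, 0 < k x) {x : X} {v : ℝ} : α x < v ↔ expectedImprovement P (f x) v < k x := by
  rw [← hα x]
  exact ⟨fun h => expectedImprovement_lt (hf x) h ((hk x).trans_eq (hα x).symm),
    fun h => (antitone_expectedImprovement (hf x)).reflect_lt h⟩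

end Index

/-! ### Amortization of the costs -/

section Bound

theorem Policy.subset_of_mem_support_run {X : Type*} [DecidableEq X] (π : Policy X)
    (r : X → ℝ) {n : ℕ} {S : Finset X}
    {o : Finset X × X} (ho : o ∈ (π.run r n S).support) : S ⊆ o.1 := by
  induction n generalizing S with
  | zero =>
    obtain ⟨a, -, rfl⟩ := (PMF.mem_support_map_iff _ _ _).1 ho
    exact subset_rfl
  | succ n ih =>
    obtain ⟨a, -, ha⟩ := (PMF.mem_support_bind_iff _ _ _).1 ho
    split_ifs at ha with h
    · rw [PMF.mem_support_pure_iff] at ha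
      subst ha
      exact subset_rfl
    · exact (Finset.subset_insert a S).trans (ih ha)

variable {X : Type*} [Fintype X] [DecidableEq X]

theorem Policy.mem_of_mem_support_run (π : Policy X) (r : X → ℝ) {n : ℕ} {S : Finset X}
    (hn : Sᶜ.card = n) {o : Finset X × X} (ho : o ∈ (π.run r n S).support) : o.2 ∈ o.1 := by
  induction n generalizing S with
  | zero =>
    obtain ⟨a, -, rfl⟩ := (PMF.mem_support_map_iff _ _ _).1 ho
    simp_all
  | succ n ih =>
    obtain ⟨a, -, ha⟩ := (PMF.mem_support_bind_iff _ _ _).1 ho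
    split_ifs at ha with h
    · rw [PMF.mem_support_pure_iff] at ha
      subst ha
      exact h
    · refine ih ?_ ha
      rw [Finset.compl_insert, Finset.card_erase_of_mem (by simpa using h), hn]
      rfl

/-- The probability that the box `x` gets opened from the open set `S`, given the rewards `r`. -/
noncomputable def Policy.openProb (π : Policy X) (r : X → ℝ) (n : ℕ) (S : Finset X) (x : X) :
    ENNReal :=
  ∑ o : Finset X × X, if x ∈ o.1 then π.run r n S o else 0

theorem Policy.openProb_of_mem (π : Policy X) (r : X → ℝ) (n : ℕ) {S : Finset X} {x : X}
    (hx : x ∈ S) : π.openProb r n S x = 1 := by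
  rw [← (π.run r n S).tsum_coe, tsum_fintype]
  refine Finset.sum_congr rfl fun o _ => ?_
  split_ifs with h
  · rfl
  · by_contra hne
    exact h (π.subset_of_mem_support_run r (Ne.symm hne) hx)

/-- Whether a box is opened is decided without looking at its own reward. -/
theorem Policy.openProb_congr (π : Policy X) {r r' : X → ℝ} {x : X}
    (h : ∀ y, y ≠ x → r y = r' y) (n : ℕ) {S : Finset X} (hx : x ∉ S) :
    π.openProb r n S x = π.openProb r' n S x := by
  have hobs (S : Finset X) (hx : x ∉ S) : obs r S = obs r' S := by
    funext y
    by_cases hy : y ∈ S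
    · simp only [obs, hy, if_true, h y fun e => hx (e ▸ hy)]
    · simp [obs, hy]
  induction n generalizing S with
  | zero => simp only [Policy.openProb, Policy.run_zero_apply, hobs S hx]
  | succ n ih =>
    have key (r : X → ℝ) : π.openProb r (n + 1) S x = ∑ a, π.act (obs r S) a *
        if a ∈ S then 0 else π.openProb r n (insert a S) x := by
      simp only [Policy.openProb, Policy.run_succ_apply, ← Finset.sum_filter]
      rw [Finset.sum_comm]
      refine Finset.sum_congr rfl fun a _ => ?_
      rw [← Finset.mul_sum]
      congr 1
      split_ifs with ha
      · refine Finset.sum_eq_zero fun o ho => if_neg ?_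
        rintro rfl
        exact hx (Finset.mem_filter.1 ho).2
      · rfl
    rw [key, key, hobs S hx]
    refine Finset.sum_congr rfl fun a _ => ?_
    congr 1
    split_ifs with ha
    · rfl
    · by_cases hax : x = a
      · rw [π.openProb_of_mem r n (hax ▸ Finset.mem_insert_self _ _),
          π.openProb_of_mem r' n (hax ▸ Finset.mem_insert_self _ _)]
      · exact ih (by simp [hax, hx])

theorem Policy.measurable_openProb (π : Policy X) (n : ℕ) (S : Finset X) (x : X) :
    Measurable fun r => π.openProb r n S x := by
  refine Finset.measurable_sum _ fun o _ => ?_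
  split_ifs
  · exact π.measurable_run n S o
  · exact measurable_const

theorem Policy.toReal_openProb (π : Policy X) (r : X → ℝ) (x : X) :
    (π.openProb r (Fintype.card X) ∅ x).toReal =
      ∑ o : Finset X × X, (π.outcome r o).toReal * if x ∈ o.1 then 1 else 0 := by
  rw [Policy.openProb, ENNReal.toReal_sum fun o _ => by split_ifs <;> simp [PMF.apply_ne_top]]
  refine Finset.sum_congr rfl fun o _ => ?_
  split_ifs <;> simp [Policy.outcome]

variable {Ω : Type*} [MeasurableSpace Ω] {P : Measure Ω} {f : X → Ω → ℝ} {k α : X → ℝ}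

/-- The event of opening `x` is independent of `f x`, so that the cost `k x` of `x` may be replaced
by the excess of `f x` over the index. -/
theorem Policy.integral_openProb_mul (π : Policy X) (hf : ∀ x, Integrable (f x) P)
    (hindep : iIndepFun f P) (hα : IsGittinsIndex P f k α) (x : X) :
    ∫ ω, (π.openProb (fun y => f y ω) (Fintype.card X) ∅ x).toReal * max 0 (f x ω - α x) ∂P =
      ∫ ω, (π.openProb (fun y => f y ω) (Fintype.card X) ∅ x).toReal * k x ∂P := by
  -- the rewards of the boxes other than `x`, completed by `0` in the box `x`
  let ext : (({x}ᶜ : Finset X) → ℝ) → X → ℝ := fun z y =>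
    if hy : y ∈ ({x}ᶜ : Finset X) then z ⟨y, hy⟩ else 0
  have hext : Measurable ext := by
    refine measurable_pi_iff.2 fun y => ?_
    by_cases hy : y ∈ ({x}ᶜ : Finset X)
    · simpa only [ext, hy, dite_true] using measurable_pi_apply _
    · simp only [ext, hy, dite_false, measurable_const]
  let q : (({x}ᶜ : Finset X) → ℝ) → ℝ := fun z =>
    (π.openProb (ext z) (Fintype.card X) ∅ x).toReal
  have hq : Measurable q := ((π.measurable_openProb _ _ _).comp hext).ennreal_toReal
  have hqf (ω : Ω) : (π.openProb (fun y => f y ω) (Fintype.card X) ∅ x).toReal =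
      q fun y => f y ω := by
    refine congrArg ENNReal.toReal (π.openProb_congr (fun y hy => ?_) _ (Finset.notMem_empty x))
    simp [ext, hy]
  have hm (y : X) : AEMeasurable (f y) P := (hf y).aemeasurable
  have hg : Measurable fun z : ({x} : Finset X) → ℝ =>
      max 0 (z ⟨x, Finset.mem_singleton_self x⟩ - α x) :=
    measurable_const.max ((measurable_pi_apply _).sub_const _)
  have hind := (hindep.indepFun_finset₀ {x}ᶜ {x} disjoint_compl_left hm).comp hq hg
  simp only [hqf]
  rw [integral_mul_const, ← hα x]
  exact hind.integral_fun_mul_eq_mul_integral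
    (hq.comp_aemeasurable (aemeasurable_pi_lambda _ fun y => hm y)).aestronglyMeasurable
    (hg.comp_aemeasurable (aemeasurable_pi_lambda _ fun y => hm y)).aestronglyMeasurable

/-- The value of the outcome `o` when the excess of each opened box over its index has to be given
back. -/
def amortizedValue {X : Type*} (α r : X → ℝ) (o : Finset X × X) : ℝ :=
  r o.2 - ∑ x ∈ o.1, max 0 (r x - α x)

/-- The expected reward, net of the costs `k`, is the expected amortized value. -/
theorem Policy.integral_amortizedValue [IsProbabilityMeasure P] (π : Policy X)
    (hf : ∀ x, Integrable (f x) P)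
    (hindep : iIndepFun f P) (hα : IsGittinsIndex P f k α) :
    ∫ ω, ∑ o, (π.outcome (fun x => f x ω) o).toReal * amortizedValue α (fun x => f x ω) o ∂P =
      π.expectedReward P f - π.expectedCost P f k := by
  have hm (y : X) : AEMeasurable (f y) P := (hf y).aemeasurable
  have key (w : X → Ω → ℝ) (ω : Ω) :
      ∑ o, (π.outcome (fun x => f x ω) o).toReal * ∑ x ∈ o.1, w x ω =
        ∑ x, (π.openProb (fun y => f y ω) (Fintype.card X) ∅ x).toReal * w x ω := by
    simp only [Policy.toReal_openProb, Finset.sum_mul]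
    rw [Finset.sum_comm]
    refine Finset.sum_congr rfl fun o _ => ?_
    simp only [mul_assoc, ← Finset.mul_sum, ite_mul, one_mul, zero_mul]
    rw [Finset.sum_ite_mem, Finset.univ_inter]
  have hI (w : X → Ω → ℝ) (hw : ∀ x, Integrable (w x) P) (x : X) :
      Integrable (fun ω => (π.openProb (fun y => f y ω) (Fintype.card X) ∅ x).toReal * w x ω)
        P := by
    simp only [Policy.toReal_openProb, Finset.sum_mul, mul_assoc]
    refine integrable_finsetSum _ fun o _ => π.integrable_outcome_mul hm ?_ o
    split_ifs <;> simp [hw x]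
  simp only [amortizedValue, mul_sub, Finset.sum_sub_distrib,
    key fun x ω => max 0 (f x ω - α x)]
  have hI1 := hI (fun x ω => max 0 (f x ω - α x)) fun x => integrable_improvement (hf x) _
  have hI2 := hI (fun x _ => k x) fun x => integrable_const _
  rw [integral_sub (integrable_finsetSum _ fun o _ => π.integrable_outcome_mul hm (hf o.2) o)
    (integrable_finsetSum _ fun x _ => hI1 x), integral_finsetSum _ fun x _ => hI1 x,
    Policy.expectedReward, Policy.expectedCost]
  simp only [key fun x _ => k x]
  rw [integral_finsetSum _ fun x _ => hI2 x]
  simp only [π.integral_openProb_mul hf hindep hα]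

theorem amortizedValue_le {X : Type*} (α r : X → ℝ) {o : Finset X × X} (ho : o.2 ∈ o.1) :
    amortizedValue α r o ≤ min (r o.2) (α o.2) := by
  have h := Finset.single_le_sum (f := fun x => max 0 (r x - α x))
    (fun x _ => le_max_left _ _) ho
  simp only [amortizedValue]
  rcases max_cases 0 (r o.2 - α o.2) with h1 | h1 <;>
    rcases min_cases (r o.2) (α o.2) with h2 | h2 <;>
    linarith

end Bound

/-! ### Optimality of the Gittins policies for the Lagrangian -/

section Optimal

theorem score_obs {X : Type*} [DecidableEq X] (α r : X → ℝ) (S : Finset X) (x : X) :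
    score α (obs r S) x = if x ∈ S then r x else α x := by
  by_cases hx : x ∈ S <;> simp [score, obs, hx]

theorem gittinsActions_nonempty {X : Type*} [Fintype X] [Nonempty X] (α : X → ℝ) (s : State X) :
    (gittinsActions α s).Nonempty := by
  obtain ⟨a, -, ha⟩ := Finset.exists_max_image Finset.univ (score α s) Finset.univ_nonempty
  exact ⟨a, by simpa [gittinsActions] using ha⟩

theorem score_le_of_mem_support {X : Type*} [Fintype X] (α : X → ℝ) (τ : TieBreakingRule X)
    {s : State X} {a : X}
    (ha : a ∈ ((gittinsPolicy α τ).act s).support) (b : X) : score α s b ≤ score α s a := by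
  have : Nonempty X := ⟨a⟩
  have h := τ.choose_mem _ _ (gittinsActions_nonempty α s) a ha
  exact (Finset.mem_filter.1 h).2 b

variable {X : Type*} [Fintype X] [DecidableEq X]

/-- A Gittins policy stops as soon as an opened box exceeds its index, and every box it opens has
an index at least as large as every capped reward `min (r b) (α b)`. These two facts are kept as
invariants of the open set `S`. -/
theorem le_amortizedValue_of_mem_support_run (α r : X → ℝ) (τ : TieBreakingRule X) {n : ℕ}
    {S : Finset X} (hn : Sᶜ.card = n)
    (h₁ : ∀ x ∈ S, α x < r x → ∀ b, b ≠ x → score α (obs r S) b < r x)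
    (h₂ : ∀ x ∈ S, ∀ b, min (r b) (α b) ≤ α x) {o : Finset X × X}
    (ho : o ∈ ((gittinsPolicy α τ).run r n S).support) (b : X) :
    min (r b) (α b) ≤ amortizedValue α r o := by
  have hfinal {S : Finset X} {a : X} (h₁ : ∀ x ∈ S, α x < r x → ∀ b, b ≠ x →
      score α (obs r S) b < r x) (h₂ : ∀ x ∈ S, ∀ b, min (r b) (α b) ≤ α x) (haS : a ∈ S)
      (ha : a ∈ ((gittinsPolicy α τ).act (obs r S)).support) :
      min (r b) (α b) ≤ amortizedValue α r (S, a) := by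
    have hmax (b : X) : score α (obs r S) b ≤ r a := by
      simpa [score_obs α r S a, haS] using score_le_of_mem_support α τ ha b
    have hsum : ∑ x ∈ S, max 0 (r x - α x) = max 0 (r a - α a) := by
      refine Finset.sum_eq_single_of_mem a haS fun x hx hxa => max_eq_left ?_
      by_contra hlt
      have h := h₁ x hx (by linarith) a hxa.symm
      have h' := hmax x
      rw [score_obs, if_pos haS] at h
      rw [score_obs, if_pos hx] at h'
      linarith
    have hb : min (r b) (α b) ≤ r a := by
      refine le_trans ?_ (hmax b)
      rw [score_obs]
      split_ifs
      · exact min_le_left _ _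
      · exact min_le_right _ _
    have hb' := h₂ a haS b
    simp only [amortizedValue, hsum]
    rcases max_cases 0 (r a - α a) with h | h <;> linarith
  induction n generalizing S with
  | zero =>
    obtain ⟨a, ha, rfl⟩ := (PMF.mem_support_map_iff _ _ _).1 ho
    exact hfinal h₁ h₂ (by simp_all) ha
  | succ n ih =>
    obtain ⟨a, ha, hao⟩ := (PMF.mem_support_bind_iff _ _ _).1 ho
    split_ifs at hao with haS
    · rw [PMF.mem_support_pure_iff] at hao
      subst hao
      exact hfinal h₁ h₂ haS ha
    have hmax (b : X) : score α (obs r S) b ≤ α a := by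
      simpa [score_obs α r S a, haS] using score_le_of_mem_support α τ ha b
    refine ih ?_ ?_ ?_ hao
    · rw [Finset.compl_insert, Finset.card_erase_of_mem (by simpa using haS), hn]
      rfl
    · intro x hx hlt b hbx
      rcases Finset.mem_insert.1 hx with rfl | hxS
      · refine lt_of_le_of_lt (le_trans (le_of_eq ?_) (hmax b)) hlt
        simp [score_obs, hbx]
      · have h := h₁ x hxS hlt a fun e => haS (e ▸ hxS)
        have h' := hmax x
        rw [score_obs, if_neg haS] at h
        rw [score_obs, if_pos hxS] at h'
        linarith
    · intro x hx b
      rcases Finset.mem_insert.1 hx with rfl | hxS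
      · refine le_trans ?_ (hmax b)
        rw [score_obs]
        split_ifs
        · exact min_le_left _ _
        · exact min_le_right _ _
      · exact h₂ x hxS b

variable {Ω : Type*} [MeasurableSpace Ω] {P : Measure Ω} [IsProbabilityMeasure P]
  {f : X → Ω → ℝ} {k α : X → ℝ}

/-- Whatever the tie-breaking rule, a Gittins policy maximizes the expected reward net of the
expected cost. -/
theorem gittinsPolicy_optimal (hf : ∀ x, Integrable (f x) P) (hindep : iIndepFun f P)
    (hα : IsGittinsIndex P f k α) (τ : TieBreakingRule X) (π : Policy X) :
    π.expectedReward P f - π.expectedCost P f k ≤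
      (gittinsPolicy α τ).expectedReward P f - (gittinsPolicy α τ).expectedCost P f k := by
  rw [← π.integral_amortizedValue hf hindep hα,
    ← (gittinsPolicy α τ).integral_amortizedValue hf hindep hα]
  have hval (o : Finset X × X) : Integrable (fun ω => amortizedValue α (fun x => f x ω) o) P :=
    (hf o.2).sub (integrable_finsetSum _ fun x _ => integrable_improvement (hf x) _)
  have hI (π : Policy X) : Integrable (fun ω => ∑ o, (π.outcome (fun x => f x ω) o).toReal *
      amortizedValue α (fun x => f x ω) o) P :=
    integrable_finsetSum _ fun o _ =>
      π.integrable_outcome_mul (fun x => (hf x).aemeasurable) (hval o) o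
  refine integral_mono (hI _) (hI _) fun ω => ?_
  set r : X → ℝ := fun x => f x ω
  have hle (o o' : Finset X × X) (ho : π.outcome r o ≠ 0)
      (ho' : (gittinsPolicy α τ).outcome r o' ≠ 0) :
      amortizedValue α r o ≤ amortizedValue α r o' :=
    (amortizedValue_le α r (π.mem_of_mem_support_run r (by simp) ho)).trans
      (le_amortizedValue_of_mem_support_run α r τ (by simp) (by simp) (by simp) ho' _)
  calc ∑ o, (π.outcome r o).toReal * amortizedValue α r o
      = ∑ o, ∑ o', (π.outcome r o).toReal * ((gittinsPolicy α τ).outcome r o').toReal *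
          amortizedValue α r o := by
        simp only [← Finset.sum_mul, ← Finset.mul_sum, Policy.sum_outcome_toReal, mul_one]
    _ ≤ ∑ o, ∑ o', (π.outcome r o).toReal * ((gittinsPolicy α τ).outcome r o').toReal *
          amortizedValue α r o' := by
        refine Finset.sum_le_sum fun o _ => Finset.sum_le_sum fun o' _ => ?_
        by_cases ho : π.outcome r o = 0
        · simp [ho]
        by_cases ho' : (gittinsPolicy α τ).outcome r o' = 0
        · simp [ho']
        exact mul_le_mul_of_nonneg_left (hle o o' ho ho')
          (mul_nonneg ENNReal.toReal_nonneg ENNReal.toReal_nonneg)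
    _ = ∑ o', ((gittinsPolicy α τ).outcome r o').toReal * amortizedValue α r o' := by
        rw [Finset.sum_comm]
        simp only [← Finset.sum_mul, Policy.sum_outcome_toReal, one_mul]

end Optimal

/-! ### Tie-breaking rules -/

section Rules

variable {X : Type*}

open Classical in
/-- An element of `A`, chosen once and for all, if `A` is nonempty. -/
noncomputable def pick [Nonempty X] (A : Finset X) : X :=
  if h : A.Nonempty then h.choose else Classical.arbitrary X

theorem pick_mem [Nonempty X] {A : Finset X} (h : A.Nonempty) : pick A ∈ A := by
  rw [pick, dif_pos h]
  exact h.choose_spec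

/-- The deterministic rule that first refines the set `A` of tied actions to `F O A`, unless that
leaves nothing, and then takes the chosen element. -/
noncomputable def refinedRule [Nonempty X] [DecidableEq X] (F : Finset X → Finset X → Finset X) :
    TieBreakingRule X where
  choose O A := PMF.pure (pick (if (F O A ∩ A).Nonempty then F O A ∩ A else A))
  choose_mem O A hA a ha := by
    rw [PMF.mem_support_pure_iff] at ha
    subst ha
    split_ifs with h
    · exact Finset.inter_subset_right (pick_mem h)
    · exact pick_mem hA

/-- The deterministic rule that takes the chosen element of the set of tied actions. -/
noncomputable def pickRule [Nonempty X] : TieBreakingRule X where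
  choose _ A := PMF.pure (pick A)
  choose_mem _ A hA a ha := by
    rw [PMF.mem_support_pure_iff] at ha
    exact ha ▸ pick_mem hA

/-- The rule that independently at each decision follows `τ₁` with probability `t`, and `τ₀` with
probability `1 - t`. -/
noncomputable def mixedRule [Fintype X] (τ₀ τ₁ : TieBreakingRule X) (t : unitInterval) :
    TieBreakingRule X where
  choose O A := PMF.ofFintype
    (fun a => ENNReal.ofReal (1 - t) * τ₀.choose O A a + ENNReal.ofReal t * τ₁.choose O A a) <| by
      rw [Finset.sum_add_distrib, ← Finset.mul_sum, ← Finset.mul_sum, ← tsum_fintype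
        (L := .unconditional _), ← tsum_fintype (L := .unconditional _), PMF.tsum_coe,
        PMF.tsum_coe, mul_one, mul_one, ← ENNReal.ofReal_add (sub_nonneg.2 t.2.2) t.2.1,
        sub_add_cancel, ENNReal.ofReal_one]
  choose_mem O A hA a ha := by
    rw [PMF.mem_support_ofFintype_iff] at ha
    by_contra haA
    have h₀ : τ₀.choose O A a = 0 := by_contra fun h => haA (τ₀.choose_mem O A hA a h)
    have h₁ : τ₁.choose O A a = 0 := by_contra fun h => haA (τ₁.choose_mem O A hA a h)
    exact ha (by rw [h₀, h₁, mul_zero, mul_zero, add_zero])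

/-- Every expected cost between those of two tie-breaking rules is the cost of a mixture. -/
theorem exists_rule_expectedCost_eq [Fintype X] [DecidableEq X] {Ω : Type*} [MeasurableSpace Ω]
    {P : Measure Ω} [IsProbabilityMeasure P] {f : X → Ω → ℝ} (hf : ∀ x, Integrable (f x) P)
    (c α : X → ℝ) {B : ℝ} {τ₀ τ₁ : TieBreakingRule X}
    (h₀ : (gittinsPolicy α τ₀).expectedCost P f c ≤ B)
    (h₁ : B ≤ (gittinsPolicy α τ₁).expectedCost P f c) :
    ∃ τ, (gittinsPolicy α τ).expectedCost P f c = B := by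
  have hcont : Continuous fun t : unitInterval =>
      (gittinsPolicy α (mixedRule τ₀ τ₁ t)).expectedCost P f c := by
    refine continuous_iff_continuousAt.2 fun t => tendsto_expectedCost hf c fun s a => ?_
    change ContinuousAt (fun t : unitInterval =>
      ENNReal.ofReal (1 - t) * τ₀.choose (openBoxes s) (gittinsActions α s) a +
        ENNReal.ofReal t * τ₁.choose (openBoxes s) (gittinsActions α s) a) t
    refine Continuous.continuousAt (.add ?_ ?_)
    · exact (ENNReal.continuous_mul_const (PMF.apply_ne_top _ _)).comp
        (ENNReal.continuous_ofReal.comp (continuous_const.sub continuous_subtype_val))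
    · exact (ENNReal.continuous_mul_const (PMF.apply_ne_top _ _)).comp
        (ENNReal.continuous_ofReal.comp continuous_subtype_val)
  have e₀ : gittinsPolicy α (mixedRule τ₀ τ₁ 0) = gittinsPolicy α τ₀ := by
    simp only [gittinsPolicy, Policy.mk.injEq]
    funext s
    refine PMF.ext fun a => ?_
    simp [mixedRule]
  have e₁ : gittinsPolicy α (mixedRule τ₀ τ₁ 1) = gittinsPolicy α τ₁ := by
    simp only [gittinsPolicy, Policy.mk.injEq]
    funext s
    refine PMF.ext fun a => ?_
    simp [mixedRule]
  obtain ⟨t, ht⟩ := mem_range_of_exists_le_of_exists_ge hcont ⟨0, e₀ ▸ h₀⟩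
    ⟨1, e₁ ▸ h₁⟩
  exact ⟨_, ht⟩

end Rules

/-! ### Limits of Gittins policies as the multiplier converges -/

section Limits

variable {X : Type*}

theorem exists_subseq_order_const [Finite X] (α : ℕ → X → ℝ) :
    ∃ φ : ℕ → ℕ, StrictMono φ ∧
      ∀ n a b, α (φ n) a ≤ α (φ n) b ↔ α (φ 0) a ≤ α (φ 0) b := by
  obtain ⟨R, hR⟩ := Finite.exists_infinite_fiber fun n => {p : X × X | α n p.1 ≤ α n p.2}
  obtain ⟨φ, hφ, h⟩ := extraction_of_frequently_atTop
    (Nat.frequently_atTop_iff_infinite.2 (Set.infinite_coe_iff.1 hR))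
  refine ⟨φ, hφ, fun n a b => ?_⟩
  have e : {p : X × X | α (φ n) p.1 ≤ α (φ n) p.2} = {p | α (φ 0) p.1 ≤ α (φ 0) p.2} :=
    (h n).trans (h 0).symm
  exact Set.ext_iff.1 e (a, b)

theorem tendsto_act_apply {p : ℕ → PMF X} {q : PMF X} (h : ∀ᶠ n in atTop, p n = q) (a : X) :
    Tendsto (fun n => p n a) atTop (𝓝 (q a)) :=
  tendsto_const_nhds.congr' (h.mono fun _ hn => congrArg (fun p : PMF X => p a) hn.symm)

/-- If the comparison of any two scores in the state `s` is eventually constant, so is the set of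
actions of the Gittins policies. -/
theorem exists_eventually_gittinsActions_eq [Fintype X] {α : ℕ → X → ℝ} {s : State X}
    (h : ∀ a b, ∃ p : Prop, ∀ᶠ n in atTop, (score (α n) s b ≤ score (α n) s a ↔ p)) :
    ∃ A, ∀ᶠ n in atTop, gittinsActions (α n) s = A := by
  classical
  choose p hp using h
  refine ⟨Finset.univ.filter fun a => ∀ b, p a b, ?_⟩
  filter_upwards [eventually_all.2 fun a => eventually_all.2 fun b => hp a b] with n hn
  ext a
  simp [gittinsActions, hn]

variable {Ω : Type*} [MeasurableSpace Ω] {P : Measure Ω} [IsProbabilityMeasure P]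
  {f : X → Ω → ℝ} {c : X → ℝ} {lam : ℕ → ℝ} {l : ℝ} {α : ℕ → X → ℝ}

theorem eventually_lt_index (hf : ∀ x, Integrable (f x) P) (hc : ∀ x, 0 < c x)
    (hlam : ∀ n, 0 < lam n) (hα : ∀ n, IsGittinsIndex P f (fun x => lam n * c x) (α n))
    (hl : Tendsto lam atTop (𝓝 l)) {x : X} {v : ℝ} (h : l * c x < expectedImprovement P (f x) v) :
    ∀ᶠ n in atTop, v < α n x :=
  ((hl.mul_const (c x)).eventually_lt_const h).mono fun n hn =>
    ((hα n).lt_iff hf fun x => mul_pos (hlam n) (hc x)).2 hn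

theorem eventually_index_lt (hf : ∀ x, Integrable (f x) P) (hc : ∀ x, 0 < c x)
    (hlam : ∀ n, 0 < lam n) (hα : ∀ n, IsGittinsIndex P f (fun x => lam n * c x) (α n))
    (hl : Tendsto lam atTop (𝓝 l)) {x : X} {v : ℝ} (h : expectedImprovement P (f x) v < l * c x) :
    ∀ᶠ n in atTop, α n x < v :=
  ((hl.mul_const (c x)).eventually_const_lt h).mono fun n hn =>
    ((hα n).gt_iff hf fun x => mul_pos (hlam n) (hc x)).2 hn

/-- As the multiplier tends to zero, a subsequence of the Gittins policies is eventually constant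
in each state. (The limit ranks a closed box by the essential supremum of its reward, which may be
infinite, so that it need not be a Gittins policy.) -/
theorem exists_limit_policy [Fintype X] [Nonempty X] (hf : ∀ x, Integrable (f x) P)
    (hc : ∀ x, 0 < c x)
    (hlam : ∀ n, 0 < lam n) (hα : ∀ n, IsGittinsIndex P f (fun x => lam n * c x) (α n))
    (hl : Tendsto lam atTop (𝓝 0)) :
    ∃ φ : ℕ → ℕ, StrictMono φ ∧ ∃ π : Policy X, ∀ s, ∀ᶠ n in atTop,
      (gittinsPolicy (α (φ n)) pickRule).act s = π.act s := by
  obtain ⟨φ, hφ, hord⟩ := exists_subseq_order_const α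
  refine ⟨φ, hφ, ?_⟩
  have hcmp (x : X) (v : ℝ) :
      (∀ᶠ n in atTop, v < α (φ n) x) ∨ (∀ᶠ n in atTop, α (φ n) x < v) := by
    rcases (expectedImprovement_nonneg P (f x) v).eq_or_lt with h | h
    · exact .inr (.of_forall fun n => ((hα _).gt_iff hf fun x => mul_pos (hlam _) (hc x)).2
        (h ▸ mul_pos (hlam _) (hc x)))
    · exact .inl (hφ.tendsto_atTop.eventually
        (eventually_lt_index hf hc hlam hα hl (by rwa [zero_mul])))
  have hconst (s : State X) : ∃ A, ∀ᶠ n in atTop, gittinsActions (α (φ n)) s = A := by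
    refine exists_eventually_gittinsActions_eq fun a b => ?_
    rcases ha : s a with v | _ <;> rcases hb : s b with w | _
    · exact ⟨w ≤ v, by simp [score, ha, hb]⟩
    · rcases hcmp b v with h | h
      · exact ⟨False, h.mono fun n hn => by simpa [score, ha, hb] using hn⟩
      · exact ⟨True, h.mono fun n hn => by simpa [score, ha, hb] using hn.le⟩
    · rcases hcmp a w with h | h
      · exact ⟨True, h.mono fun n hn => by simpa [score, ha, hb] using hn.le⟩
      · exact ⟨False, h.mono fun n hn => by simpa [score, ha, hb] using hn⟩
    · exact ⟨α (φ 0) b ≤ α (φ 0) a, .of_forall fun n => by simpa [score, ha, hb] using hord n b a⟩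
  choose A hA using hconst
  have hact (s : State X) : ∀ᶠ n in atTop,
      (gittinsPolicy (α (φ n)) pickRule).act s = PMF.pure (pick (A s)) :=
    (hA s).mono fun n hn => congrArg (fun A => PMF.pure (pick A)) hn
  refine ⟨⟨fun s => PMF.pure (pick (A s)), fun a => ?_⟩, hact⟩
  exact measurable_of_tendsto_metrizable
    (fun n => (gittinsPolicy (α (φ n)) pickRule).measurable_act a)
    (tendsto_pi_nhds.2 fun s => tendsto_act_apply (hact s) a)

theorem mem_openBoxes [Fintype X] {s : State X} {x : X} :
    x ∈ openBoxes s ↔ (s x).isLeft = true := by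
  simp [openBoxes]

/-- As the multiplier tends to `l > 0` strictly from one side, a subsequence of the Gittins policies
is eventually equal, in each state, to a Gittins policy for the multiplier `l`. The indices
converge, so that strict inequalities between scores persist; in a tie between an open and a closed
box, the side from which the multiplier converges tells which of them is preferred, and ties between
closed boxes are decided by the constant order along the subsequence. -/
theorem exists_limit_rule [Fintype X] [Nonempty X] [DecidableEq X] (hf : ∀ x, Integrable (f x) P)
    (hc : ∀ x, 0 < c x)
    (hlam : ∀ n, 0 < lam n) (hα : ∀ n, IsGittinsIndex P f (fun x => lam n * c x) (α n))
    (hl : Tendsto lam atTop (𝓝 l)) (hl0 : 0 < l) (hside : (∀ n, lam n < l) ∨ ∀ n, l < lam n)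
    {β : X → ℝ} (hβ : IsGittinsIndex P f (fun x => l * c x) β) :
    ∃ φ : ℕ → ℕ, StrictMono φ ∧ ∃ τ : TieBreakingRule X, ∀ s, ∀ᶠ n in atTop,
      (gittinsPolicy (α (φ n)) pickRule).act s = (gittinsPolicy β τ).act s := by
  classical
  obtain ⟨φ, hφ, hord⟩ := exists_subseq_order_const α
  -- `T O a b` decides `score b ≤ score a` for actions which are tied in the limit
  let T : Finset X → X → X → Prop := fun O a b =>
    if b ∈ O then (a ∈ O ∨ ∀ n, lam n < l)
    else (if a ∈ O then ∀ n, l < lam n else α (φ 0) b ≤ α (φ 0) a)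
  refine ⟨φ, hφ, refinedRule fun O A => A.filter fun a => ∀ b ∈ A, T O a b, fun s => ?_⟩
  have hβl {x : X} {v : ℝ} : v < β x ↔ l * c x < expectedImprovement P (f x) v :=
    hβ.lt_iff hf fun x => mul_pos hl0 (hc x)
  have hβg {x : X} {v : ℝ} : β x < v ↔ expectedImprovement P (f x) v < l * c x :=
    hβ.gt_iff hf fun x => mul_pos hl0 (hc x)
  have htend (x : X) : Tendsto (fun n => α (φ n) x) atTop (𝓝 (β x)) :=
    Tendsto.comp (tendsto_order.2
      ⟨fun v hv => eventually_lt_index hf hc hlam hα hl (hβl.1 hv),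
        fun v hv => eventually_index_lt hf hc hlam hα hl (hβg.1 hv)⟩) hφ.tendsto_atTop
  have hscore (x : X) : Tendsto (fun n => score (α (φ n)) s x) atTop (𝓝 (score β s x)) := by
    rcases hx : s x with v | _
    · simp [score, hx]
    · simpa [score, hx] using htend x
  have hup (h : ∀ n, lam n < l) (n : ℕ) (x : X) : β x < α n x :=
    ((hα n).lt_iff hf fun x => mul_pos (hlam n) (hc x)).2
      (by rw [hβ x]; exact mul_lt_mul_of_pos_right (h n) (hc x))
  have hdown (h : ∀ n, l < lam n) (n : ℕ) (x : X) : α n x < β x :=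
    ((hα n).gt_iff hf fun x => mul_pos (hlam n) (hc x)).2
      (by rw [hβ x]; exact mul_lt_mul_of_pos_right (h n) (hc x))
  -- a converging sequence cannot lie on both sides of its limit
  have hexcl : ¬ ((∀ n, lam n < l) ∧ ∀ n, l < lam n) := fun h => (h.1 0).not_gt (h.2 0)
  have hT (n : ℕ) {a b : X} (hab : score β s a = score β s b) :
      score (α (φ n)) s b ≤ score (α (φ n)) s a ↔ T (openBoxes s) a b := by
    simp only [T, mem_openBoxes]
    rcases ha : s a with v | _ <;> rcases hb : s b with w | _ <;>
      simp only [score, ha, hb, Sum.elim_inl, Sum.elim_inr] at hab <;>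
      simp only [score, ha, hb, Sum.elim_inl, Sum.elim_inr, Sum.isLeft_inl, Sum.isLeft_inr,
        if_true, true_or, iff_true, Bool.false_eq_true, false_or, if_false]
    · exact hab.ge
    · rcases hside with h | h
      · exact iff_of_false (hab ▸ hup h _ b).not_ge fun h' => hexcl ⟨h, h'⟩
      · exact iff_of_true (hab ▸ hdown h _ b).le h
    · rcases hside with h | h
      · exact iff_of_true (hab ▸ hup h _ a).le h
      · exact iff_of_false (hab ▸ hdown h _ a).not_ge fun h' => hexcl ⟨h', h⟩
    · exact hord n b a
  have hmem {γ : X → ℝ} {a : X} :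
      a ∈ gittinsActions γ s ↔ ∀ b, score γ s b ≤ score γ s a := by
    simp [gittinsActions]
  have hev : ∀ᶠ n in atTop, ∀ a b, score β s b < score β s a →
      score (α (φ n)) s b < score (α (φ n)) s a := by
    refine eventually_all.2 fun a => eventually_all.2 fun b => ?_
    by_cases h : score β s b < score β s a
    · exact ((hscore b).eventually_lt (hscore a) h).mono fun n hn _ => hn
    · exact .of_forall fun n hlt => (h hlt).elim
  filter_upwards [hev] with n hn
  have hset : gittinsActions (α (φ n)) s = (gittinsActions β s).filter fun a =>
      ∀ b ∈ gittinsActions β s, T (openBoxes s) a b := by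
    ext a
    rw [Finset.mem_filter]
    constructor
    · intro ha
      have haβ : a ∈ gittinsActions β s := hmem.2 fun b => by
        by_contra! hlt
        exact (hn b a hlt).not_ge (hmem.1 ha b)
      exact ⟨haβ, fun b hb => (hT n (le_antisymm (hmem.1 hb a) (hmem.1 haβ b))).1 (hmem.1 ha b)⟩
    · rintro ⟨haβ, ha⟩
      refine hmem.2 fun b => ?_
      by_cases hb : b ∈ gittinsActions β s
      · exact (hT n (le_antisymm (hmem.1 hb a) (hmem.1 haβ b))).2 (ha b hb)
      · obtain ⟨d, hd⟩ := not_forall.1 fun h => hb (hmem.2 h)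
        exact (hn a b ((not_le.1 hd).trans_le (hmem.1 haβ d))).le
  have hne := hset ▸ gittinsActions_nonempty (α (φ n)) s
  change PMF.pure (pick (gittinsActions (α (φ n)) s)) = PMF.pure (pick _)
  rw [hset, if_pos (by rwa [Finset.inter_eq_left.2 (Finset.filter_subset _ _)]),
    Finset.inter_eq_left.2 (Finset.filter_subset _ _)]

end Limits

/-! ### The multiplier and the tie-breaking rule that exhaust the budget -/

section Multiplier

variable {X : Type*} [Fintype X] [DecidableEq X]

/-- The policy that opens the box `x` and takes the reward in it. -/
noncomputable def openOnly (x : X) : Policy X where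
  act _ := PMF.pure x
  measurable_act _ := measurable_const

theorem outcome_openOnly (x : X) (r : X → ℝ) : (openOnly x).outcome r = PMF.pure ({x}, x) := by
  have : Nonempty X := ⟨x⟩
  obtain ⟨n, hn⟩ := Nat.exists_eq_succ_of_ne_zero (Fintype.card_ne_zero (α := X))
  rw [Policy.outcome, hn]
  cases n <;> simp [Policy.run, openOnly, PMF.pure_bind, PMF.pure_map]

variable {Ω : Type*} [MeasurableSpace Ω] {P : Measure Ω} {f : X → Ω → ℝ} {c : X → ℝ} {B : ℝ}

theorem expectedCost_openOnly [IsProbabilityMeasure P] (x : X) :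
    (openOnly x).expectedCost P f c = c x := by
  simp only [Policy.expectedCost, outcome_openOnly, PMF.pure_apply]
  rw [Finset.sum_eq_single ({x}, x)] <;> simp +contextual

theorem Policy.expectedCost_const_mul (π : Policy X) (t : ℝ) :
    π.expectedCost P f (fun x => t * c x) = t * π.expectedCost P f c := by
  simp only [Policy.expectedCost, ← integral_const_mul, Finset.mul_sum]
  simp only [mul_left_comm]

variable [IsProbabilityMeasure P]

/-- For a large multiplier the Gittins policies cost at most `B`: otherwise opening only a box
cheaper than `B` would be better. -/
theorem exists_multiplier_expectedCost_le (hf : ∀ x, Integrable (f x) P) (hindep : iIndepFun f P)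
    {x : X} (hx : c x < B) :
    ∃ t > 0, ∀ (α : X → ℝ) (τ : TieBreakingRule X), IsGittinsIndex P f (fun x => t * c x) α →
      (gittinsPolicy α τ).expectedCost P f c ≤ B := by
  set M := ∫ ω, ∑ x, |f x ω| ∂P
  have hM : 0 ≤ M := integral_nonneg fun ω => Finset.sum_nonneg fun _ _ => abs_nonneg _
  have hBx : 0 < B - c x := sub_pos.2 hx
  refine ⟨(2 * M + 1) / (B - c x), by positivity, fun α τ hα => ?_⟩
  by_contra! hlt
  have h := gittinsPolicy_optimal hf hindep hα τ (openOnly x)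
  rw [Policy.expectedCost_const_mul, Policy.expectedCost_const_mul, expectedCost_openOnly] at h
  have h1 := (abs_le.1 ((openOnly x).abs_expectedReward_le hf)).1
  have h2 := (abs_le.1 ((gittinsPolicy α τ).abs_expectedReward_le hf)).2
  have h3 : (2 * M + 1) / (B - c x) * (B - c x) = 2 * M + 1 := div_mul_cancel₀ _ hBx.ne'
  have h4 : (2 * M + 1) / (B - c x) * B < (2 * M + 1) / (B - c x) *
      (gittinsPolicy α τ).expectedCost P f c := mul_lt_mul_of_pos_left hlt (by positivity)
  rw [mul_sub] at h3
  linarith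

/-- A Gittins policy that exhausts the budget is optimal among the policies within the budget. -/
theorem isBudgetOptimal_of_expectedCost_eq (hf : ∀ x, Integrable (f x) P)
    (hindep : iIndepFun f P) {t : ℝ} (ht : 0 < t) {α : X → ℝ}
    (hα : IsGittinsIndex P f (fun x => t * c x) α) {τ : TieBreakingRule X}
    (h : (gittinsPolicy α τ).expectedCost P f c = B) :
    IsBudgetOptimal P f c B (gittinsPolicy α τ) := by
  refine ⟨h.le, fun π hπ => ?_⟩
  have hopt := gittinsPolicy_optimal hf hindep hα τ π
  rw [Policy.expectedCost_const_mul, Policy.expectedCost_const_mul, h] at hopt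
  have := mul_le_mul_of_nonneg_left hπ ht.le
  linarith

/-- If the budget is active, the Gittins policies for multipliers tending to zero cannot all stay
within the budget, because the limit policy would then be an unconstrained optimum. -/
theorem not_tendsto_zero_of_budgetActive [Nonempty X] (hf : ∀ x, Integrable (f x) P)
    (hindep : iIndepFun f P) (hc : ∀ x, 0 < c x) (hactive : BudgetActive P f c B)
    {lam : ℕ → ℝ} {α : ℕ → X → ℝ} (hlam : ∀ n, 0 < lam n)
    (hα : ∀ n, IsGittinsIndex P f (fun x => lam n * c x) (α n))
    (hB : ∀ n, (gittinsPolicy (α n) pickRule).expectedCost P f c ≤ B) :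
    ¬ Tendsto lam atTop (𝓝 0) := by
  intro hl
  obtain ⟨φ, hφ, π, hπ⟩ := exists_limit_policy hf hc hlam hα hl
  have hcost := tendsto_expectedCost hf c fun s a => tendsto_act_apply (hπ s) a
  have hreward := tendsto_expectedReward hf fun s a => tendsto_act_apply (hπ s) a
  refine (hactive π fun π' => ?_).not_ge (le_of_tendsto' hcost fun n => hB _)
  have hl' := hl.comp hφ.tendsto_atTop
  refine le_of_tendsto_of_tendsto'
    (f := fun n => π'.expectedReward P f - lam (φ n) * π'.expectedCost P f c)
    (g := fun n => (gittinsPolicy (α (φ n)) pickRule).expectedReward P f -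
      lam (φ n) * (gittinsPolicy (α (φ n)) pickRule).expectedCost P f c)
    (by simpa using (hl'.mul_const (π'.expectedCost P f c)).const_sub (π'.expectedReward P f))
    (by simpa using hreward.sub (hl'.mul hcost)) fun n => ?_
  have h := gittinsPolicy_optimal hf hindep (hα (φ n)) pickRule π'
  rwa [Policy.expectedCost_const_mul, Policy.expectedCost_const_mul] at h

end Multiplier

end Pandora

theorem theorem2 {Ω X : Type*} [MeasurableSpace Ω] (P : MeasureTheory.Measure Ω)
    [MeasureTheory.IsProbabilityMeasure P] [Fintype X] [DecidableEq X]
    (f : X → Ω → ℝ) (hf : ∀ x, MeasureTheory.Integrable (f x) P)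
    (hindep : ProbabilityTheory.iIndepFun f P)
    (c : X → ℝ) (hc : ∀ x, 0 < c x)
    (B : ℝ) (hmin : ∃ x, c x < B) (hsum : B < ∑ x, c x)
    (hactive : Pandora.BudgetActive P f c B) :
    ∃ lam : ℝ, 0 < lam ∧
      ∃ α : X → ℝ, Pandora.IsGittinsIndex P f (fun x => lam * c x) α ∧
        ∃ τ : Pandora.TieBreakingRule X,
          Pandora.IsBudgetOptimal P f c B (Pandora.gittinsPolicy α τ) := by
  open Pandora in
  obtain ⟨x, hx⟩ := hmin
  have : Nonempty X := ⟨x⟩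
  have hex (t : ℝ) : ∃ α : X → ℝ, 0 < t → IsGittinsIndex P f (fun x => t * c x) α := by
    by_cases ht : 0 < t
    · obtain ⟨α, hα⟩ := exists_isGittinsIndex hf fun x => mul_pos ht (hc x)
      exact ⟨α, fun _ => hα⟩
    · exact ⟨0, fun h => (ht h).elim⟩
  choose α hα using hex
  -- the limit is at most `B` from the right of the infimum of `L`, and at least `B` from the left
  let L : Set ℝ := {t | 0 < t ∧ (gittinsPolicy (α t) pickRule).expectedCost P f c ≤ B}
  have hLne : L.Nonempty := by
    obtain ⟨t, ht, h⟩ := exists_multiplier_expectedCost_le hf hindep hx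
    exact ⟨t, ht, h _ _ (hα t ht)⟩
  have hLbdd : BddBelow L := ⟨0, fun t ht => ht.1.le⟩
  obtain ⟨u, -, hu, huL⟩ := exists_seq_tendsto_sInf hLne hLbdd
  have hl : 0 < sInf L := by
    refine lt_of_le_of_ne (le_csInf hLne fun t ht => ht.1.le) fun h => ?_
    exact not_tendsto_zero_of_budgetActive hf hindep hc hactive (fun n => (huL n).1)
      (fun n => hα _ (huL n).1) (fun n => (huL n).2) (h ▸ hu)
  have hlim {v : ℕ → ℝ} (hv : ∀ n, 0 < v n) (hvl : Tendsto v atTop (𝓝 (sInf L)))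
      (hside : (∀ n, v n < sInf L) ∨ ∀ n, sInf L < v n) :
      ∃ φ : ℕ → ℕ, ∃ τ : TieBreakingRule X,
        Tendsto (fun n => (gittinsPolicy (α (v (φ n))) pickRule).expectedCost P f c) atTop
          (𝓝 ((gittinsPolicy (α (sInf L)) τ).expectedCost P f c)) := by
    obtain ⟨φ, -, τ, hτ⟩ := exists_limit_rule hf hc hv (fun n => hα _ (hv n)) hvl hl hside
      (hα _ hl)
    exact ⟨φ, τ, tendsto_expectedCost hf c fun s a => tendsto_act_apply (hτ s) a⟩
  have h₀ : ∃ τ, (gittinsPolicy (α (sInf L)) τ).expectedCost P f c ≤ B := by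
    by_cases hmem : sInf L ∈ L
    · exact ⟨_, hmem.2⟩
    · obtain ⟨φ, τ, hτ⟩ := hlim (fun n => (huL n).1) hu (.inr fun n =>
        lt_of_le_of_ne (csInf_le hLbdd (huL n)) fun h => hmem (h ▸ huL n))
      exact ⟨τ, le_of_tendsto' hτ fun n => (huL _).2⟩
  have h₁ : ∃ τ, B ≤ (gittinsPolicy (α (sInf L)) τ).expectedCost P f c := by
    obtain ⟨v, -, hv, hvl⟩ := exists_seq_strictMono_tendsto' hl
    obtain ⟨φ, τ, hτ⟩ := hlim (fun n => (hv n).1) hvl (.inl fun n => (hv n).2)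
    refine ⟨τ, ge_of_tendsto' hτ fun n => ?_⟩
    by_contra! hlt
    exact notMem_of_lt_csInf (hv (φ n)).2 hLbdd ⟨(hv _).1, hlt.le⟩
  obtain ⟨τ₀, h₀⟩ := h₀
  obtain ⟨τ₁, h₁⟩ := h₁
  obtain ⟨τ, hτ⟩ := exists_rule_expectedCost_eq hf c _ h₀ h₁
  exact ⟨sInf L, hl, _, hα _ hl, τ, isBudgetOptimal_of_expectedCost_eq hf hindep hl (hα _ hl) hτ⟩
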